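/- Let $\Gamma$ be a nontrivial left-orderable group (i.e. $\Gamma$ admits a total order $<$ such that $f<g$ implies $hf<hg$ for all $f,g,h\in\Gamma$), generated by a finite set $S$, and let $l:\Gamma\to[0,\infty)$ be the word length with respect to $S$. Let $\mu_\Gamma$ be a probability measure on $\Gamma$ which is symmetric ($\mu_\Gamma(\gamma^{-1})=\mu_\Gamma(\gamma)$ for all $\gamma$), has full support ($\mu_\Gamma(\gamma)>0$ for all $\gamma\in\Gamma$) and has finite second moment, $\sum_{\gamma\in\Gamma} l(\gamma)^2\,\mu_\Gamma(\gamma)<\infty$. Then there exist a nonempty compact metrizable space $Z$, a continuous flow $T=\{T^s\}_{s\in\mathbb R}$ on $Z$ which is free ($T^s(p)=p$ for some $p \in Z$ implies $s=0$) and minimal (every $T$-trajectory is dense in $Z$), and an action of $\Gamma$ on $Z$ by homeomorphisms, such that 1. $\Gamma$ has no global fixed point in $Z$, i.e. no point of $Z$ is fixed by all of $\Gamma$; 2. every $T$-trajectory is $\Gamma$-invariant; hence, $T$ being free, there is a unique function $t:\Gamma\times Z\to\mathbb R$ such that $\gamma(p)=T^{t(\gamma,p)}(p)$ for all $(\gamma,p)\in\Gamma\times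 Z$; 3. for every $p\in Z$ the displacements are $\mu_\Gamma$-integrable with zero mean: the series $\sum_{\gamma\in\Gamma} t(\gamma,p)\,\mu_\Gamma(\gamma)$ converges absolutely and its sum is $0$. -/

import Mathlib

universe u

/-- A group is left-orderable if it carries a total order that is invariant under left
multiplication. -/
def LeftOrderable (Γ : Type u) [Group Γ] : Prop :=
  ∃ _ : LinearOrder Γ, ∀ f g h : Γ, f < g → h * f < h * g

/-- The word length of `g` with respect to `S`: the least length of a word in the letters
`s` and `s⁻¹`, `s ∈ S`, whose product is `g`. (When `S` generates the group, every element is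
such a product.) -/
noncomputable def wordLength {Γ : Type u} [Group Γ] (S : Finset Γ) (g : Γ) : ℕ :=
  sInf {n : ℕ | ∃ w : List Γ, w.length = n ∧ (∀ x ∈ w, x ∈ S ∨ x⁻¹ ∈ S) ∧ w.prod = g}

/-- The flow is free: no nonzero time fixes a point. -/
def IsFreeFlow {Z : Type u} [TopologicalSpace Z] (T : Flow ℝ Z) : Prop :=
  ∀ (s : ℝ) (p : Z), T s p = p → s = 0

/-- The flow is minimal: every trajectory is dense. -/
def IsMinimalFlow {Z : Type u} [TopologicalSpace Z] (T : Flow ℝ Z) : Prop :=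
  ∀ p : Z, Dense (T.orbit p)

/-- `t` records the displacement of the points of `Z` under `Γ`, measured in the time of the
flow: `γ • p = T ^ {t (γ, p)} (p)`. -/
def IsDisplacement {Γ Z : Type u} [SMul Γ Z] [TopologicalSpace Z]
    (T : Flow ℝ Z) (t : Γ → Z → ℝ) : Prop :=
  ∀ (γ : Γ) (p : Z), γ • p = T (t γ p) p

/-! Up to a torus factor, the points of `Z` are actions `ρ` of `Γ` on the line under which every `x`
is the mean of its images `ρ k x`. The flow conjugates by translations, and `γ` moves `ρ` along its
trajectory by time `ρ γ 0`. Such actions are needed with uniform control: displacements bounded by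
word length for compactness, and energy bounded below to exclude fixed points.

The resolvent of the random walk with discount `r` puts positive weights of total mass 1 on `Γ`.
Cuts of the order, with one element possibly split, are parametrized by their mass `x ∈ [0, 1]`, so
left translations become monotone maps `φ k` of `[0, 1]`. The resolvent equation makes the mean
displacement `ε * (x - f x)`, where `ε = (1 - r) / r` and `f x` is the portion of the identity below
the cut (`exists_interval_action`).

Integrating this drift and applying Young's equality to the pairs `φ k`, `φ k⁻¹` gives nonnegative
areas near `x` with mean `2 * ε * ∫ (z - f z)` (`hasSum_excess`). An area controls the squared
displacement, so displacements are of order `δ = √ε`. It is also at most the product of the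
displacements of `k` and `k⁻¹`; as `f` vanishes on some `[0, c]` with `c` independent of `ε`, the
energy at `c` is at least `c ^ 2 * ε`. Zooming in at `c` by `1 / δ` and letting `δ → 0` yields a
harmonic action without fixed points. A minimal set of the translation flow times an irrational
torus flow is then the required space. -/

open scoped ENNReal

/-! ### Resolvent of the random walk -/

section Resolvent

variable {Γ : Type u} [Group Γ]

/-- The `n`-step transition weights of the walk `g ↦ γ * g` towards the identity. -/
noncomputable def stepWeight (p : Γ → ℝ≥0∞) : ℕ → Γ → ℝ≥0∞
  | 0 => Set.indicator {1} 1
  | n + 1 => fun g => ∑' k, p k * stepWeight p n (k * g)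

theorem tsum_stepWeight (p : Γ → ℝ≥0∞) (hp : ∑' k, p k = 1) (n : ℕ) :
    ∑' g, stepWeight p n g = 1 := by
  induction n with
  | zero =>
    rw [tsum_eq_single (1 : Γ)]
    · simp [stepWeight]
    · intro b hb
      simp [stepWeight, hb]
  | succ n ih =>
    simp only [stepWeight]
    rw [ENNReal.tsum_comm]
    have : ∀ k : Γ, ∑' g, p k * stepWeight p n (k * g) = p k := by
      intro k
      rw [ENNReal.tsum_mul_left, show ∑' i, stepWeight p n (k * i) = _ from (Equiv.mulLeft k).tsum_eq (stepWeight p n),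
        ih, mul_one]
    simp [this, hp]

/-- The resolvent of the walk at the identity, for the discount factor `r`. -/
noncomputable def resolventWeight (p : Γ → ℝ≥0∞) (r : ℝ≥0∞) (g : Γ) : ℝ≥0∞ :=
  (1 - r) * ∑' n, r ^ n * stepWeight p n g

theorem tsum_resolventWeight (p : Γ → ℝ≥0∞) (hp : ∑' k, p k = 1) {r : ℝ≥0∞} (hr : r < 1) :
    ∑' g, resolventWeight p r g = 1 := by
  simp only [resolventWeight]
  rw [ENNReal.tsum_mul_left, ENNReal.tsum_comm]
  simp only [ENNReal.tsum_mul_left, tsum_stepWeight p hp, mul_one]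
  rw [ENNReal.tsum_geometric]
  exact ENNReal.mul_inv_cancel (tsub_pos_of_lt hr).ne' (by simp)

theorem resolventWeight_eq (p : Γ → ℝ≥0∞) (r : ℝ≥0∞) (g : Γ) :
    resolventWeight p r g =
      r * ∑' k, p k * resolventWeight p r (k * g) + (1 - r) * (Set.indicator {1} 1 : Γ → ℝ≥0∞) g := by
  have h : ∑' n, r ^ n * stepWeight p n g = (Set.indicator {1} 1 : Γ → ℝ≥0∞) g +
      r * ∑' k, p k * ∑' n, r ^ n * stepWeight p n (k * g) := by
    rw [tsum_eq_zero_add' ENNReal.summable]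
    simp only [pow_zero, one_mul, stepWeight]
    congr 1
    simp only [← ENNReal.tsum_mul_left]
    rw [ENNReal.tsum_comm]
    refine tsum_congr fun k => tsum_congr fun n => ?_
    ring
  simp only [resolventWeight]
  rw [h, mul_add, add_comm]
  congr 1
  simp only [← ENNReal.tsum_mul_left]
  refine tsum_congr fun k => tsum_congr fun n => ?_
  ring

theorem resolventWeight_pos (p : Γ → ℝ≥0∞) (hp : ∀ k, p k ≠ 0) {r : ℝ≥0∞} (hr : r < 1)
    (hr0 : r ≠ 0) (g : Γ) : resolventWeight p r g ≠ 0 := by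
  -- One step suffices: the increment `g⁻¹` leads from `g` to the identity.
  have h1 : (r ^ 1 * stepWeight p 1 g) ≠ 0 := by
    simp only [stepWeight, pow_one]
    refine mul_ne_zero hr0 fun h => ?_
    rw [ENNReal.tsum_eq_zero] at h
    have := h g⁻¹
    simp [hp] at this
  refine mul_ne_zero (tsub_pos_of_lt hr).ne' fun h => h1 ?_
  rw [ENNReal.tsum_eq_zero] at h
  exact h 1

theorem exists_resolvent (μ : PMF Γ) (hsupp : μ.support = Set.univ) {r : ℝ} (hr0 : 0 < r)
    (hr : r < 1) :
    ∃ w : Γ → ℝ, (∀ g, 0 < w g) ∧ HasSum w 1 ∧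
      ∀ g, HasSum (fun k => r * ((μ k).toReal * w (k * g)))
        (w g - (1 - r) * (Set.indicator {1} 1 : Γ → ℝ) g) := by
  set R := ENNReal.ofReal r
  have hR0 : R ≠ 0 := by simpa [R] using hr0
  have hR : R < 1 := by simpa [R] using hr
  have hRt : R ≠ ⊤ := ENNReal.ofReal_ne_top
  have hRr : R.toReal = r := ENNReal.toReal_ofReal hr0.le
  set W := resolventWeight (fun k => μ k) R
  have hW1 : ∑' g, W g = 1 := tsum_resolventWeight _ μ.tsum_coe hR
  have hμ : ∀ k, μ k ≠ 0 := fun k => by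
    rw [← PMF.mem_support_iff, hsupp]; trivial
  have hWt : ∀ g, W g ≠ ⊤ := fun g =>
    ENNReal.ne_top_of_tsum_ne_top (by rw [hW1]; simp) g
  refine ⟨fun g => (W g).toReal, fun g =>
    ENNReal.toReal_pos (resolventWeight_pos _ hμ hR hR0 g) (hWt g), ?_, fun g => ?_⟩
  · have := ENNReal.hasSum_toReal (f := W) (by rw [hW1]; simp)
    rwa [← ENNReal.tsum_toReal_eq hWt, hW1, ENNReal.toReal_one] at this
  · have h := resolventWeight_eq (fun k => μ k) R g
    change W g = R * ∑' k, μ k * W (k * g) + _ at h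
    rw [← ENNReal.tsum_mul_left] at h
    have hfin : ∑' k, R * (μ k * W (k * g)) ≠ ⊤ := by
      intro hh
      rw [hh, top_add] at h
      exact hWt g h
    have h2 := ENNReal.hasSum_toReal hfin
    have hfin' : (1 - R) * (Set.indicator {1} 1 : Γ → ℝ≥0∞) g ≠ ⊤ := by
      intro hh
      rw [hh, add_top] at h
      exact hWt g h
    have h3 := congrArg ENNReal.toReal h
    rw [ENNReal.toReal_add hfin hfin', ENNReal.tsum_toReal_eq
      (ENNReal.ne_top_of_tsum_ne_top hfin)] at h3
    have h4 : ((1 - R) * (Set.indicator {1} 1 : Γ → ℝ≥0∞) g).toReal =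
        (1 - r) * (Set.indicator {1} 1 : Γ → ℝ) g := by
      rw [ENNReal.toReal_mul, ENNReal.toReal_sub_of_le hR.le (by simp), hRr]
      by_cases hg : g = 1
      · subst hg; simp
      · simp [hg]
    rw [h4] at h3
    have h5 : (W g).toReal - (1 - r) * (Set.indicator {1} 1 : Γ → ℝ) g =
        ∑' k, (R * (μ k * W (k * g))).toReal := by linarith
    rw [h5]
    simpa [ENNReal.toReal_mul, hRr] using h2

end Resolvent

theorem HasSum.of_forall_eq {ι : Type*} {f g : ι → ℝ} {a : ℝ} (h : HasSum f a)
    (e : ∀ i, g i = f i) : HasSum g a := by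
  rwa [funext e]

/-! ### Cuts of a weighted order -/

section SoftCut

variable {Γ : Type u}

/-- A cut of a linear order in which one element may be cut in the middle: `a g` is the portion
of `g` that lies in the lower part. -/
structure IsSoftCut [LinearOrder Γ] (a : Γ → ℝ) : Prop where
  nonneg : ∀ g, 0 ≤ a g
  le_one : ∀ g, a g ≤ 1
  eq_one : ∀ g k, g < k → 0 < a k → a g = 1

/-- Below an element with positive portion everything is full, so two cuts cannot cross. -/
theorem IsSoftCut.total [LinearOrder Γ] {a b : Γ → ℝ} (ha : IsSoftCut a) (hb : IsSoftCut b) :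
    a ≤ b ∨ b ≤ a := by
  by_contra! h
  obtain ⟨h1, h2⟩ := h
  simp only [Pi.le_def, not_forall, not_le] at h1 h2
  obtain ⟨g, hg⟩ := h1
  obtain ⟨k, hk⟩ := h2
  rcases lt_trichotomy g k with h | h | h
  · have := hb.eq_one g k h ((ha.nonneg k).trans_lt hk)
    linarith [ha.le_one g]
  · subst h; linarith
  · have := ha.eq_one k g h ((hb.nonneg g).trans_lt hg)
    linarith [hb.le_one k]

theorem IsSoftCut.summable [LinearOrder Γ] {a w : Γ → ℝ} (ha : IsSoftCut a) (hw : ∀ g, 0 < w g)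
    (hw1 : HasSum w 1) : Summable fun g => w g * a g :=
  Summable.of_nonneg_of_le (fun g => mul_nonneg (hw g).le (ha.nonneg g))
    (fun g => mul_le_of_le_one_right (hw g).le (ha.le_one g)) hw1.summable

/-- Soft cuts are ordered by their heights. -/
theorem IsSoftCut.le_of_height_le [LinearOrder Γ] {a b w : Γ → ℝ} (ha : IsSoftCut a)
    (hb : IsSoftCut b) (hw : ∀ g, 0 < w g) {x y : ℝ}
    (hx : HasSum (fun g => w g * a g) x) (hy : HasSum (fun g => w g * b g) y) (hxy : x ≤ y) :
    a ≤ b := by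
  rcases ha.total hb with h | h
  · exact h
  · intro g
    by_contra! hg
    have : y < x := hasSum_lt (i := g) (fun k => mul_le_mul_of_nonneg_left (h k) (hw k).le)
      (mul_lt_mul_of_pos_left hg (hw g)) hy hx
    linarith

theorem exists_isSoftCut [LinearOrder Γ] {w : Γ → ℝ} (hw : ∀ g, 0 < w g)
    (hw1 : HasSum w 1) {x : ℝ} (hx0 : 0 ≤ x) (hx1 : x ≤ 1) :
    ∃ a : Γ → ℝ, IsSoftCut a ∧ HasSum (fun g => w g * a g) x := by
  classical
  have hI : ∀ s : Set Γ, Summable (s.indicator w) := fun s => hw1.summable.indicator s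
  set F : Γ → ℝ := fun g => ∑' k, (Set.Iio g).indicator w k with hF
  -- `F g` is the mass strictly below `g`. If `x` lies in the jump at `g`, then `g` is split.
  by_cases hg : ∃ g, F g ≤ x ∧ x ≤ F g + w g
  · obtain ⟨g, h1, h2⟩ := hg
    refine ⟨fun k => if k < g then 1 else if k = g then (x - F g) / w g else 0, ⟨?_, ?_, ?_⟩, ?_⟩
    · intro k
      have : 0 ≤ (x - F g) / w g := div_nonneg (by linarith) (hw g).le
      split_ifs <;> simp [this]
    · intro k
      have : (x - F g) / w g ≤ 1 := by rw [div_le_one (hw g)]; linarith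
      split_ifs <;> simp [this]
    · intro j k hjk hk
      have : k ≤ g := by
        by_contra! h
        simp [h.not_gt, h.ne'] at hk
      rw [if_pos (hjk.trans_le this)]
    · have h3 : HasSum ((Set.Iio g).indicator w) (F g) := (hI _).hasSum
      have h4 := h3.add (hasSum_ite_eq g (x - F g))
      convert h4 using 1
      · funext k
        rcases lt_trichotomy k g with h | h | h
        · simp [h, h.ne]
        · subst h; simp [mul_div_cancel₀ _ (hw k).ne']
        · simp [h.not_gt, h.ne']
      · ring
  · push Not at hg
    have key : ∀ g, F g + w g < x ∨ x < F g := by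
      intro g
      rcases lt_or_ge x (F g) with h | h
      · exact Or.inr h
      · exact Or.inl (hg g h)
    have hIic : ∀ g (s : Finset Γ), (∀ k ∈ s, k ≤ g) → ∑ k ∈ s, w k ≤ F g + w g := by
      intro g s hs
      have h3 : HasSum ((Set.Iio g).indicator w) (F g) := (hI _).hasSum
      have h4 := h3.add (hasSum_ite_eq g (w g))
      refine le_trans (Finset.sum_le_sum fun k hk => ?_) (sum_le_hasSum s (fun k _ => ?_) h4)
      · rcases (hs k hk).lt_or_eq with h | h
        · simp [h, h.ne]
        · subst h; simp
      · refine add_nonneg (Set.indicator_nonneg (fun _ _ => (hw _).le) _) ?_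
        split_ifs
        · exact (hw g).le
        · exact le_rfl
    have hIci : ∀ g (s : Finset Γ), (∀ k ∈ s, g ≤ k) → ∑ k ∈ s, w k ≤ 1 - F g := by
      intro g s hs
      have h3 : HasSum ((Set.Iio g).indicator w) (F g) := (hI _).hasSum
      have h4 := hw1.sub h3
      refine le_trans (Finset.sum_le_sum fun k hk => ?_) (sum_le_hasSum s (fun k _ => ?_) h4)
      · simp [(hs k hk).not_gt]
      · by_cases h : k < g <;> simp [h, (hw k).le]
    have hmono : ∀ g k, g < k → F g + w g ≤ F k := by
      intro g k hgk
      have h3 : HasSum ((Set.Iio g).indicator w) (F g) := (hI _).hasSum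
      have h4 := h3.add (hasSum_ite_eq g (w g))
      refine hasSum_le (fun j => ?_) h4 (hI (Set.Iio k)).hasSum
      rcases lt_trichotomy j g with h | h | h
      · simp [h, h.ne, h.trans hgk]
      · subst h; simp [hgk]
      · simp only [Set.indicator, Set.mem_Iio, h.not_gt, h.ne', if_false, add_zero]
        split_ifs
        · exact (hw j).le
        · exact le_rfl
    -- Here no jump contains `x`. Finite subsets of `D` have mass at most `x`, by their maximum;
    -- those of `Dᶜ` have mass at most `1 - x`, by their minimum. The total is 1, so `D` has mass
    -- exactly `x`.
    set D : Set Γ := {g | F g + w g < x} with hD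
    have hup : ∑' k, D.indicator w k ≤ x := by
      refine (hI D).tsum_le_of_sum_le fun s => ?_
      rw [← Finset.sum_filter_add_sum_filter_not s (· ∈ D)]
      rw [Finset.sum_eq_zero (s := s.filter (· ∉ D)) (fun k hk => by
        simp [(Finset.mem_filter.1 hk).2]), add_zero]
      rw [Finset.sum_congr rfl (fun k hk => by
        rw [Set.indicator_of_mem (Finset.mem_filter.1 hk).2] :
          ∀ k ∈ s.filter (· ∈ D), D.indicator w k = w k)]
      rcases (s.filter (· ∈ D)).eq_empty_or_nonempty with h | h
      · simp [h, hx0]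
      · have hmem := (Finset.mem_filter.1 (Finset.max'_mem _ h)).2
        exact (hIic _ _ fun k hk => Finset.le_max' _ k hk).trans (le_of_lt hmem)
    have hdown : ∑' k, Dᶜ.indicator w k ≤ 1 - x := by
      refine (hI Dᶜ).tsum_le_of_sum_le fun s => ?_
      rw [← Finset.sum_filter_add_sum_filter_not s (· ∈ Dᶜ)]
      rw [Finset.sum_eq_zero (s := s.filter (· ∉ Dᶜ)) (fun k hk => by
        rw [Set.indicator_of_notMem (Finset.mem_filter.1 hk).2]), add_zero]
      rw [Finset.sum_congr rfl (fun k hk => by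
        rw [Set.indicator_of_mem (Finset.mem_filter.1 hk).2] :
          ∀ k ∈ s.filter (· ∈ Dᶜ), Dᶜ.indicator w k = w k)]
      rcases (s.filter (· ∈ Dᶜ)).eq_empty_or_nonempty with h | h
      · rw [h, Finset.sum_empty]; linarith
      · have hmem := (Finset.mem_filter.1 (Finset.min'_mem _ h)).2
        refine (hIci (Finset.min' _ h) _ fun k hk => Finset.min'_le _ k hk).trans ?_
        rcases key (Finset.min' _ h) with h' | h'
        · exact absurd h' hmem
        · linarith
    have hsum : ∑' k, D.indicator w k + ∑' k, Dᶜ.indicator w k = 1 := by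
      rw [← (hI D).tsum_add (hI Dᶜ), ← hw1.tsum_eq]
      exact tsum_congr fun k => by
        rw [← Pi.add_apply, Set.indicator_self_add_compl]
    refine ⟨D.indicator 1, ⟨fun k => Set.indicator_nonneg (fun _ _ => zero_le_one) k,
      fun k => Set.indicator_le_self' (fun _ _ => zero_le_one) k, fun j k hjk hk => ?_⟩, ?_⟩
    · have hkD : k ∈ D := by
        by_contra h
        simp [h] at hk
      have : j ∈ D := by
        have h1 : F k + w k < x := hkD
        change F j + w j < x
        linarith [hmono j k hjk, hw k]
      simp [this]
    · have : ∑' k, D.indicator w k = x := by linarith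
      rw [← this]
      convert (hI D).hasSum using 1
      funext k
      by_cases h : k ∈ D <;> simp [h]

theorem isSoftCut_indicator_Iio [LinearOrder Γ] (g : Γ) :
    IsSoftCut ((Set.Iio g).indicator (1 : Γ → ℝ)) := by
  refine ⟨fun k => Set.indicator_nonneg (fun _ _ => zero_le_one) k,
      fun k => Set.indicator_le_self' (fun _ _ => zero_le_one) k, fun j k hjk hk => ?_⟩
  have hkD : k < g := by
    by_contra h
    simp [h] at hk
  simp [hjk.trans hkD]

end SoftCut

/-! ### The action on cuts and its drift -/

section IntervalAction

variable {Γ : Type u} [Group Γ]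

theorem IsSoftCut.translate [LinearOrder Γ] (hord : ∀ f g h : Γ, f < g → h * f < h * g)
    {a : Γ → ℝ} (ha : IsSoftCut a) (γ : Γ) : IsSoftCut fun g => a (γ⁻¹ * g) :=
  ⟨fun _ => ha.nonneg _, fun _ => ha.le_one _, fun _ _ h => ha.eq_one _ _ (hord _ _ _ h)⟩

/-- A left-invariant order and a resolvent weight turn the left translations into an action on
the line, supported in `[0, 1]`, whose mean displacement is small and explicit. -/
theorem exists_interval_action [LinearOrder Γ] (hord : ∀ f g h : Γ, f < g → h * f < h * g)
    {m w : Γ → ℝ} (hm : ∀ k, 0 < m k) (hm1 : HasSum m 1) {r : ℝ} (hr0 : 0 < r)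
    (hw : ∀ g, 0 < w g) (hw1 : HasSum w 1)
    (hres : ∀ g, HasSum (fun k => r * (m k * w (k * g)))
        (w g - (1 - r) * (Set.indicator {1} 1 : Γ → ℝ) g)) :
    ∃ (φ : Γ → ℝ → ℝ) (f : ℝ → ℝ), (∀ x, φ 1 x = x) ∧ (∀ g k x, φ (g * k) x = φ g (φ k x)) ∧
      (∀ g, Monotone (φ g)) ∧ Monotone f ∧ (∀ g, ∀ x ∉ Set.Ioo (0 : ℝ) 1, φ g x = x) ∧
      (∀ x ∈ Set.Icc (0 : ℝ) 1, f x ∈ Set.Icc (0 : ℝ) 1) ∧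
      (∀ x ∉ Set.Icc (0 : ℝ) 1, f x = x) ∧
      (∀ x, 0 ≤ x → x ≤ ∑' g, (Set.Iio (1 : Γ)).indicator w g → f x = 0) ∧
      ∀ x, HasSum (fun k => r * (m k * φ k x)) (x - (1 - r) * f x) := by
  classical
  have hex : ∀ x : ℝ, ∃ a : Γ → ℝ, x ∈ Set.Icc (0 : ℝ) 1 →
      IsSoftCut a ∧ HasSum (fun g => w g * a g) x := by
    intro x
    by_cases hx : x ∈ Set.Icc (0 : ℝ) 1
    · obtain ⟨a, ha⟩ := exists_isSoftCut hw hw1 hx.1 hx.2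
      exact ⟨a, fun _ => ha⟩
    · exact ⟨0, fun h => absurd h hx⟩
  choose A hA using hex
  have hcut : ∀ x ∈ Set.Icc (0 : ℝ) 1, IsSoftCut (A x) := fun x hx => (hA x hx).1
  have hht : ∀ x ∈ Set.Icc (0 : ℝ) 1, HasSum (fun g => w g * A x g) x := fun x hx => (hA x hx).2
  have hAuniq : ∀ x ∈ Set.Icc (0 : ℝ) 1, ∀ b, IsSoftCut b → HasSum (fun g => w g * b g) x →
      b = A x := fun x hx b hb hbx =>
    le_antisymm (hb.le_of_height_le (hcut x hx) hw hbx (hht x hx) le_rfl)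
      ((hcut x hx).le_of_height_le hb hw (hht x hx) hbx le_rfl)
  have hAmono : ∀ x ∈ Set.Icc (0 : ℝ) 1, ∀ y ∈ Set.Icc (0 : ℝ) 1, x ≤ y → A x ≤ A y :=
    fun x hx y hy hxy => (hcut x hx).le_of_height_le (hcut y hy) hw (hht x hx) (hht y hy) hxy
  -- The height of the `γ`-translate of the cut of height `x`. Outside `[0, 1]` both `φ γ` and `f`
  -- are the identity, so the drift vanishes there.
  set φ : Γ → ℝ → ℝ := fun γ x =>
    if x ∈ Set.Icc (0 : ℝ) 1 then ∑' g, w g * A x (γ⁻¹ * g) else x with hφ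
  set f : ℝ → ℝ := fun x => if x ∈ Set.Icc (0 : ℝ) 1 then A x 1 else x with hf
  have hφin : ∀ γ, ∀ x ∈ Set.Icc (0 : ℝ) 1, HasSum (fun g => w g * A x (γ⁻¹ * g)) (φ γ x) := by
    intro γ x hx
    simp only [hφ, if_pos hx]
    exact (((hcut x hx).translate hord γ).summable hw hw1).hasSum
  have hφout : ∀ γ, ∀ x ∉ Set.Icc (0 : ℝ) 1, φ γ x = x := fun γ x hx => if_neg hx
  have hheight : ∀ (b : Γ → ℝ) (y : ℝ), IsSoftCut b → HasSum (fun g => w g * b g) y →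
      y ∈ Set.Icc (0 : ℝ) 1 := fun b y hb hy =>
    ⟨hy.nonneg fun g => mul_nonneg (hw g).le (hb.nonneg g),
      hasSum_le (fun g => mul_le_of_le_one_right (hw g).le (hb.le_one g)) hy hw1⟩
  have hφmem : ∀ γ, ∀ x ∈ Set.Icc (0 : ℝ) 1, φ γ x ∈ Set.Icc (0 : ℝ) 1 := fun γ x hx =>
    hheight _ _ ((hcut x hx).translate hord γ) (hφin γ x hx)
  have hAφ : ∀ γ, ∀ x ∈ Set.Icc (0 : ℝ) 1, (fun g => A x (γ⁻¹ * g)) = A (φ γ x) := fun γ x hx =>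
    hAuniq _ (hφmem γ x hx) _ ((hcut x hx).translate hord γ) (hφin γ x hx)
  have h0 : (0 : ℝ) ∈ Set.Icc (0 : ℝ) 1 := by simp
  have h1 : (1 : ℝ) ∈ Set.Icc (0 : ℝ) 1 := by simp
  have hA0 : A 0 = 0 := (hAuniq 0 h0 0
    ⟨fun _ => le_rfl, fun _ => zero_le_one, fun _ _ _ h => absurd h (lt_irrefl _)⟩
    (by simp)).symm
  have hA1 : A 1 = 1 := (hAuniq 1 h1 1
    ⟨fun _ => zero_le_one, fun _ => le_rfl, fun _ _ _ _ => rfl⟩ (by simpa using hw1)).symm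
  refine ⟨φ, f, ?_, ?_, ?_, ?_, ?_, ?_, ?_, ?_, ?_⟩
  · intro x
    by_cases hx : x ∈ Set.Icc (0 : ℝ) 1
    · have := hφin 1 x hx
      simp only [inv_one, one_mul] at this
      exact this.unique (hht x hx)
    · exact hφout _ x hx
  · intro g k x
    by_cases hx : x ∈ Set.Icc (0 : ℝ) 1
    · have h2 := hφin g _ (hφmem k x hx)
      rw [← hAφ k x hx] at h2
      refine (hφin (g * k) x hx).unique ?_
      simpa [mul_assoc] using h2
    · rw [hφout _ x hx, hφout _ x hx, hφout _ x hx]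
  · intro g x y hxy
    by_cases hx : x ∈ Set.Icc (0 : ℝ) 1
    · by_cases hy : y ∈ Set.Icc (0 : ℝ) 1
      · exact hasSum_le (fun k => mul_le_mul_of_nonneg_left (hAmono x hx y hy hxy _) (hw k).le)
          (hφin g x hx) (hφin g y hy)
      · rw [hφout _ y hy]
        by_contra! h
        exact hy ⟨hx.1.trans hxy, h.le.trans (hφmem g x hx).2⟩
    · rw [hφout _ x hx]
      by_cases hy : y ∈ Set.Icc (0 : ℝ) 1
      · by_contra! h
        exact hx ⟨(hφmem g y hy).1.trans h.le, hxy.trans hy.2⟩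
      · rwa [hφout _ y hy]
  · intro x y hxy
    by_cases hx : x ∈ Set.Icc (0 : ℝ) 1
    · by_cases hy : y ∈ Set.Icc (0 : ℝ) 1
      · simp only [hf, if_pos hx, if_pos hy]
        exact hAmono x hx y hy hxy 1
      · simp only [hf, if_pos hx, if_neg hy]
        by_contra! h
        exact hy ⟨hx.1.trans hxy, h.le.trans ((hcut x hx).le_one _)⟩
    · by_cases hy : y ∈ Set.Icc (0 : ℝ) 1
      · simp only [hf, if_neg hx, if_pos hy]
        by_contra! h
        exact hx ⟨((hcut y hy).nonneg _).trans h.le, hxy.trans hy.2⟩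
      · simpa only [hf, if_neg hx, if_neg hy]
  · intro g x hx
    by_cases hx' : x ∈ Set.Icc (0 : ℝ) 1
    · have : x = 0 ∨ x = 1 := by
        by_contra! h
        exact hx ⟨lt_of_le_of_ne hx'.1 h.1.symm, lt_of_le_of_ne hx'.2 h.2⟩
      rcases this with rfl | rfl
      · refine (hφin g 0 h0).unique ?_
        simp [hA0]
      · refine (hφin g 1 h1).unique ?_
        simpa [hA1] using hw1
    · exact hφout _ x hx'
  · intro x hx
    simp only [hf, if_pos hx]
    exact ⟨(hcut x hx).nonneg _, (hcut x hx).le_one _⟩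
  · intro x hx
    simp only [hf, if_neg hx]
  · intro x hx0 hx
    have hsum : HasSum (fun g => w g * (Set.Iio (1 : Γ)).indicator (1 : Γ → ℝ) g)
        (∑' g, (Set.Iio (1 : Γ)).indicator w g) := by
      refine (hw1.summable.indicator (Set.Iio (1 : Γ))).hasSum.of_forall_eq fun k => ?_
      by_cases h : k < 1 <;> simp [h]
    have hx1 : x ≤ 1 := hx.trans (hheight _ _ (isSoftCut_indicator_Iio 1) hsum).2
    have hle := (hcut x ⟨hx0, hx1⟩).le_of_height_le (isSoftCut_indicator_Iio 1) hw
      (hht x ⟨hx0, hx1⟩) hsum hx 1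
    simp only [hf, if_pos (show x ∈ Set.Icc (0 : ℝ) 1 from ⟨hx0, hx1⟩)]
    refine le_antisymm ?_ ((hcut x ⟨hx0, hx1⟩).nonneg _)
    simpa using hle
  · intro x
    by_cases hx : x ∈ Set.Icc (0 : ℝ) 1
    · simp only [hf, if_pos hx]
      -- After the substitution `g ↦ k * g` in the heights, summing over `k` first brings in the
      -- resolvent equation; nonnegativity permits the exchange.
      have hrow : ∀ g, HasSum (fun k => r * (m k * w (k * g)) * A x g)
          ((w g - (1 - r) * (Set.indicator {1} 1 : Γ → ℝ) g) * A x g) :=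
        fun g => (hres g).mul_right _
      have hrows : HasSum
          (fun g => (w g - (1 - r) * (Set.indicator {1} 1 : Γ → ℝ) g) * A x g)
          (x - (1 - r) * A x 1) := by
        have h2 := (hht x hx).sub (hasSum_ite_eq (1 : Γ) ((1 - r) * A x 1))
        refine h2.of_forall_eq fun g => ?_
        by_cases hg : g = 1
        · subst hg; simp; ring
        · simp [hg]
      have hsum : Summable fun q : Γ × Γ => r * (m q.2 * w (q.2 * q.1)) * A x q.1 := by
        rw [summable_prod_of_nonneg]
        · refine ⟨fun g => (hrow g).summable, ?_⟩
          convert hrows.summable using 1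
          funext g
          exact (hrow g).tsum_eq
        · intro q
          have := hm q.2
          have := hw (q.2 * q.1)
          have := (hcut x hx).nonneg q.1
          change 0 ≤ r * (m q.2 * w (q.2 * q.1)) * A x q.1
          positivity
      have htot := hsum.hasSum
      rw [(htot.prod_fiberwise hrow).unique hrows] at htot
      have hswap := (Equiv.prodComm Γ Γ).hasSum_iff.2 htot
      refine hswap.prod_fiberwise fun k => ?_
      have h2 := ((hφin k x hx).mul_left (m k)).mul_left r
      rw [← (Equiv.mulLeft k).hasSum_iff] at h2
      refine h2.of_forall_eq fun g => ?_
      simp only [Function.comp_apply, Equiv.coe_mulLeft, inv_mul_cancel_left, Equiv.prodComm_apply,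
        Prod.fst_swap, Prod.snd_swap]
      ring
    · simp only [hf, hφout _ x hx, if_neg hx]
      have := (hm1.mul_right x).mul_left r
      have e : x - (1 - r) * x = r * (1 * x) := by ring
      rwa [e]

end IntervalAction

/-! ### Interval actions with small drift -/

section Approximation

/-- An action of `Γ` on the line by monotone maps supported in `[0, 1]` whose mean displacement
at `x` is `ε * (x - f x)`, where `f` vanishes on `[0, c]`. -/
structure IsResolventAction {Γ : Type u} [Group Γ] (m : Γ → ℝ) (c ε : ℝ) (φ : Γ → ℝ → ℝ)
    (f : ℝ → ℝ) : Prop where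
  one : ∀ x, φ 1 x = x
  mul : ∀ g k x, φ (g * k) x = φ g (φ k x)
  mono : ∀ g, Monotone (φ g)
  mono_drift : Monotone f
  eq_self : ∀ g, ∀ x ∉ Set.Ioo (0 : ℝ) 1, φ g x = x
  drift_mem : ∀ x ∈ Set.Icc (0 : ℝ) 1, f x ∈ Set.Icc (0 : ℝ) 1
  drift_eq_self : ∀ x ∉ Set.Icc (0 : ℝ) 1, f x = x
  drift_eq_zero : ∀ x, 0 ≤ x → x ≤ c → f x = 0
  hasSum : ∀ x, HasSum (fun k => m k * (φ k x - x)) (ε * (x - f x))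
  sub_le : ∀ g u v, u ≤ v → m g * (φ g v - φ g u) ≤ 2 * (v - u)

/-- If too little mass lies below the identity, enough lies above, and the opposite order is again
left-invariant. -/
theorem exists_order_initial_weight {Γ : Type u} [Group Γ] (hΓ : LeftOrderable Γ) {w : Γ → ℝ}
    (hw1 : HasSum w 1) {c : ℝ} (hc : w 1 ≤ 1 - 2 * c) :
    ∃ _ : LinearOrder Γ, (∀ f g h : Γ, f < g → h * f < h * g) ∧
      c ≤ ∑' g, (Set.Iio (1 : Γ)).indicator w g := by
  obtain ⟨o, ho⟩ := hΓ
  by_cases h : c ≤ ∑' g, (Set.Iio (1 : Γ)).indicator w g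
  · exact ⟨o, ho, h⟩
  · refine ⟨(inferInstance : LinearOrder Γᵒᵈ), fun f g h hfg => ho g f h hfg, ?_⟩
    change c ≤ ∑' g, (Set.Ioi (1 : Γ)).indicator w g
    have h1 := (hw1.summable.indicator (Set.Iio (1 : Γ))).hasSum
    have h2 := (hw1.summable.indicator (Set.Ioi (1 : Γ))).hasSum
    have h3 := (h1.add h2).add (hasSum_ite_eq (1 : Γ) (w 1))
    have h4 := (h3.of_forall_eq (g := w) fun g => by
      rcases lt_trichotomy g 1 with h | h | h
      · simp [h, h.ne, h.not_gt]
      · subst h; simp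
      · simp [h, h.ne', h.not_gt]).unique hw1
    push Not at h
    linarith

theorem exists_resolventAction {Γ : Type u} [Group Γ] [Nontrivial Γ] (hΓ : LeftOrderable Γ)
    (μ : PMF Γ) (hsupp : μ.support = Set.univ) :
    ∃ c : ℝ, 0 < c ∧ c ≤ 1 ∧ ∀ ε : ℝ, 0 < ε → ε ≤ 1 →
      ∃ φ f, IsResolventAction (fun g => (μ g).toReal) c ε φ f := by
  set m : Γ → ℝ := fun g => (μ g).toReal with hm
  have hmpos : ∀ g, 0 < m g := fun g => ENNReal.toReal_pos
    (by rw [← PMF.mem_support_iff, hsupp]; trivial) (μ.apply_ne_top g)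
  have hm1 : HasSum m 1 := by
    have := ENNReal.hasSum_toReal (f := μ) (by rw [μ.tsum_coe]; simp)
    rwa [← ENNReal.tsum_toReal_eq μ.apply_ne_top, μ.tsum_coe, ENNReal.toReal_one] at this
  have hmle : ∀ g, m g ≤ 1 := fun g => le_hasSum hm1 g fun k _ => (hmpos k).le
  obtain ⟨s, hs⟩ := exists_ne (1 : Γ)
  -- This `c` is independent of `ε`: if `w 1 ≥ 1 / 2`, the resolvent equation at `s⁻¹` gives `w s⁻¹
  -- ≥ r * m s * w 1 ≥ m s / 4`, hence `w 1 ≤ 1 - 2 * c`.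
  refine ⟨m s / 8, by have := hmpos s; positivity, by linarith [hmle s], fun ε hε hε1 => ?_⟩
  set r : ℝ := 1 / (1 + ε) with hr
  have hr0 : 0 < r := by positivity
  have hr1 : r < 1 := by rw [hr, div_lt_one (by linarith)]; linarith
  have hr2 : 1 / 2 ≤ r := one_div_le_one_div_of_le (by linarith) (by linarith)
  have hrε : 1 - r = r * ε := by rw [hr]; field_simp; ring
  obtain ⟨w, hw, hw1, hres⟩ := exists_resolvent μ hsupp hr0 hr1
  have hws : r * (m s * w 1) ≤ w s⁻¹ := by
    have h1 := le_hasSum (hres s⁻¹) s fun k _ =>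
      mul_nonneg hr0.le (mul_nonneg (hmpos k).le (hw _).le)
    simpa [hs] using h1
  have hw2 : w 1 + w s⁻¹ ≤ 1 := by
    classical
    have h2 := sum_le_hasSum {1, s⁻¹} (fun k _ => (hw k).le) hw1
    rwa [Finset.sum_pair (by simpa [eq_comm] using hs)] at h2
  have hw1c : w 1 ≤ 1 - 2 * (m s / 8) := by
    rcases le_total (w 1) (1 / 2) with h | h
    · linarith [hmle s]
    · have h1 : m s * (1 / 2) ≤ m s * w 1 := mul_le_mul_of_nonneg_left h (hmpos s).le
      have h2 : 1 / 2 * (m s * w 1) ≤ r * (m s * w 1) :=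
        mul_le_mul_of_nonneg_right hr2 (mul_pos (hmpos s) (hw 1)).le
      linarith
  obtain ⟨o, ho, hoc⟩ := exists_order_initial_weight hΓ hw1 hw1c
  obtain ⟨φ, f, h1, h2, h3, h4, h5, h6, h7, h8, h9⟩ :=
    exists_interval_action ho hmpos hm1 hr0 hw hw1 hres
  refine ⟨φ, f, h1, h2, h3, h4, h5, h6, h7, fun x hx0 hx => h8 x hx0 (hx.trans hoc), ?_, ?_⟩
  · intro x
    have h10 := ((h9 x).mul_left r⁻¹).sub (hm1.mul_right x)
    have e : ε * (x - f x) = r⁻¹ * (x - (1 - r) * f x) - 1 * x := by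
      have : r⁻¹ = 1 + ε := by rw [hr]; simp
      have h11 : r * (1 + ε) = 1 := by rw [hr]; field_simp
      rw [hrε, this]
      linear_combination ε * f x * h11
    rw [e]
    refine h10.of_forall_eq fun k => ?_
    rw [inv_mul_cancel_left₀ hr0.ne']
    ring
  · intro g u v huv
    -- All `φ k` and `f` are monotone, so each term of the difference is nonnegative and at most `v
    -- - u`; the factor 2 comes from `r ≥ 1 / 2`.
    have h10 := (h9 v).sub (h9 u)
    have h11 := le_hasSum h10 g fun k _ => by
      have := mul_le_mul_of_nonneg_left (h3 k huv) (mul_nonneg hr0.le (hmpos k).le)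
      change 0 ≤ r * (m k * φ k v) - r * (m k * φ k u)
      linarith
    have h12 : (1 - r) * f u ≤ (1 - r) * f v :=
      mul_le_mul_of_nonneg_left (h4 huv) (by linarith)
    have h13 : 0 ≤ m g * (φ g v - φ g u) :=
      mul_nonneg (hmpos g).le (sub_nonneg.2 (h3 g huv))
    have h14 := mul_le_mul_of_nonneg_right hr2 h13
    change r * (m g * φ g v) - r * (m g * φ g u) ≤ _ at h11
    linarith

end Approximation

/-! ### Young's equality and area estimates -/

section Young

open intervalIntegral
open MeasureTheory (volume)

/-- Equality case of Young's inequality. -/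
theorem integral_add_integral_inverse {φ ψ : ℝ → ℝ} (hφ : Monotone φ) (hψ : Monotone ψ)
    (hψφ : ∀ x, ψ (φ x) = x) (h0 : φ 0 = 0) {L : ℝ}
    (hL : ∀ x y, |φ y - φ x| ≤ L * |y - x|) (x : ℝ) :
    (∫ z in (0 : ℝ)..x, φ z) + ∫ z in (0 : ℝ)..φ x, ψ z = x * φ x := by
  set F : ℝ → ℝ := fun x => (∫ z in (0 : ℝ)..x, φ z) + (∫ z in (0 : ℝ)..φ x, ψ z) - x * φ x
  have hφi : ∀ a b, IntervalIntegrable φ volume a b := fun a b => hφ.intervalIntegrable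
  have hψi : ∀ a b, IntervalIntegrable ψ volume a b := fun a b => hψ.intervalIntegrable
  -- Quadratic increments force a zero derivative without differentiability of `φ`.
  have key : ∀ x y, |F y - F x| ≤ 2 * L * |y - x| ^ 2 := by
    intro x y
    have e : F y - F x = (∫ z in x..y, (φ z - φ y)) + ∫ z in φ x..φ y, (ψ z - x) := by
      rw [integral_sub (hφi _ _) (by simp), integral_sub (hψi _ _) (by simp),
        ← integral_interval_sub_left (hφi 0 y) (hφi 0 x),
        ← integral_interval_sub_left (hψi 0 (φ y)) (hψi 0 (φ x))]
      simp only [F, integral_const, smul_eq_mul]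
      ring
    have h1 : ‖∫ z in x..y, (φ z - φ y)‖ ≤ |φ y - φ x| * |y - x| := by
      refine norm_integral_le_of_norm_le_const fun z hz => ?_
      rw [Real.norm_eq_abs]
      rcases le_total x y with h | h
      · rw [Set.uIoc_of_le h] at hz
        have := hφ hz.1.le
        have := hφ hz.2
        rw [abs_of_nonpos (by linarith), abs_of_nonneg (by linarith)]
        linarith
      · rw [Set.uIoc_of_ge h] at hz
        have := hφ hz.1.le
        have := hφ hz.2
        rw [abs_of_nonneg (by linarith), abs_of_nonpos (by linarith)]
        linarith
    have h2 : ‖∫ z in φ x..φ y, (ψ z - x)‖ ≤ |y - x| * |φ y - φ x| := by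
      refine norm_integral_le_of_norm_le_const fun z hz => ?_
      rw [Real.norm_eq_abs]
      rcases le_total x y with h | h
      · rw [Set.uIoc_of_le (hφ h)] at hz
        have h3 := hψ hz.1.le
        have h4 := hψ hz.2
        rw [hψφ] at h3 h4
        rw [abs_of_nonneg (by linarith), abs_of_nonneg (by linarith)]
        linarith
      · rw [Set.uIoc_of_ge (hφ h)] at hz
        have h3 := hψ hz.1.le
        have h4 := hψ hz.2
        rw [hψφ] at h3 h4
        rw [abs_of_nonpos (by linarith), abs_of_nonpos (by linarith)]
        linarith
    rw [e]
    have h3 := mul_le_mul_of_nonneg_right (hL x y) (abs_nonneg (y - x))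
    rw [Real.norm_eq_abs] at h1 h2
    calc _ ≤ _ := abs_add_le _ _
      _ ≤ _ := add_le_add h1 h2
      _ ≤ _ := by nlinarith
  have hder : ∀ x, HasDerivAt F 0 x := by
    intro x
    have h1 : (fun y => F y - F x) =O[nhds x] fun y => ‖y - x‖ ^ 2 := by
      refine Asymptotics.IsBigO.of_bound (2 * L) (Filter.Eventually.of_forall fun y => ?_)
      simpa using key x y
    have h2 := (h1.hasFDerivAt (by norm_num : 1 < 2)).hasDerivAt
    simpa using h2.add_const (F x)
  have hc := is_const_of_deriv_eq_zero (fun x => (hder x).differentiableAt)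
    (fun x => (hder x).deriv) x 0
  simp only [F, h0, integral_same] at hc
  linarith

/-- Young's equality at `ψ x` turns an integral over `[0, x]` into an area located between `ψ x` and
`x`. -/
theorem integral_add_inverse_sub {φ ψ : ℝ → ℝ} (hφ : Monotone φ) (hψ : Monotone ψ)
    (hψφ : ∀ x, ψ (φ x) = x) (hφψ : ∀ x, φ (ψ x) = x) (h0 : φ 0 = 0) {L : ℝ}
    (hL : ∀ x y, |φ y - φ x| ≤ L * |y - x|) (x : ℝ) :
    ∫ z in (0 : ℝ)..x, (φ z + ψ z - 2 * z) = ∫ z in ψ x..x, (φ z - x) := by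
  have hφi : ∀ a b, IntervalIntegrable φ volume a b := fun a b => hφ.intervalIntegrable
  have hψi : ∀ a b, IntervalIntegrable ψ volume a b := fun a b => hψ.intervalIntegrable
  have h1 := integral_add_integral_inverse hφ hψ hψφ h0 hL (ψ x)
  rw [hφψ] at h1
  rw [integral_sub ((hφi _ _).add (hψi _ _))
      (g := fun z => 2 * z) ((continuous_const.mul continuous_id).intervalIntegrable _ _),
    integral_add (hφi _ _) (hψi _ _), integral_sub (hφi _ _) (by simp),
    ← integral_interval_sub_left (hφi 0 x) (hφi 0 (ψ x)), integral_const_mul, integral_id]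
  simp only [integral_const, smul_eq_mul]
  linarith

theorem integral_inverse_sub_le {φ ψ : ℝ → ℝ} (hφ : Monotone φ)
    (hφψ : ∀ x, φ (ψ x) = x) (x : ℝ) :
    ∫ z in ψ x..x, (φ z - x) ≤ |φ x - x| * |ψ x - x| := by
  have h1 : ‖∫ z in ψ x..x, (φ z - x)‖ ≤ |φ x - x| * |x - ψ x| := by
    refine norm_integral_le_of_norm_le_const fun z hz => ?_
    rw [Real.norm_eq_abs]
    rcases le_total (ψ x) x with h | h
    · rw [Set.uIoc_of_le h] at hz
      have h3 := hφ hz.1.le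
      have h4 := hφ hz.2
      rw [hφψ] at h3
      rw [abs_of_nonneg (by linarith), abs_of_nonneg (by linarith)]
      linarith
    · rw [Set.uIoc_of_ge h] at hz
      have h3 := hφ hz.1.le
      have h4 := hφ hz.2
      rw [hφψ] at h4
      rw [abs_of_nonpos (by linarith), abs_of_nonpos (by linarith)]
      linarith
  rw [abs_sub_comm (ψ x)]
  exact (le_abs_self _).trans h1

theorem integral_inverse_sub_nonneg {φ ψ : ℝ → ℝ} (hφ : Monotone φ)
    (hφψ : ∀ x, φ (ψ x) = x) (x : ℝ) : 0 ≤ ∫ z in ψ x..x, (φ z - x) := by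
  rcases le_total (ψ x) x with h | h
  · refine integral_nonneg h fun z hz => ?_
    have := hφ hz.1
    rw [hφψ] at this
    linarith
  · rw [integral_symm, ← integral_neg]
    refine integral_nonneg h fun z hz => ?_
    have := hφ hz.2
    rw [hφψ] at this
    linarith

/-- With `H = φ x - x`, the Lipschitz bound keeps `φ z - x ≥ H / 2` on an interval of length `H / (2
* L)` ending at `x`, so the area is at least `H ^ 2 / (4 * L)`. -/
theorem sq_le_integral_inverse_sub {φ ψ : ℝ → ℝ} (hφ : Monotone φ)
    (hφψ : ∀ x, φ (ψ x) = x) {L : ℝ} (hL0 : 0 < L)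
    (hL : ∀ x y, |φ y - φ x| ≤ L * |y - x|) {x : ℝ} (hx : x ≤ φ x) :
    (φ x - x) ^ 2 ≤ 4 * L * ∫ z in ψ x..x, (φ z - x) := by
  have hφi : ∀ a b, IntervalIntegrable (fun z => φ z - x) volume a b := fun a b =>
    (hφ.intervalIntegrable).sub (by simp)
  set H := φ x - x with hH
  rcases (sub_nonneg.2 hx).eq_or_lt with hH0 | hH0
  · rw [hH, ← hH0, zero_pow two_ne_zero]
    exact mul_nonneg (by positivity) (integral_inverse_sub_nonneg hφ hφψ x)
  change 0 < H at hH0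
  set v := x - H / (2 * L) with hv
  have hvx : v ≤ x := by
    have : 0 ≤ H / (2 * L) := by positivity
    linarith
  have hLv : L * (x - v) = H / 2 := by rw [hv]; field_simp; ring
  have hLb : ∀ z ≤ x, φ x - φ z ≤ L * (x - z) := fun z hz => by
    have := hL z x
    rwa [abs_of_nonneg (sub_nonneg.2 (hφ hz)), abs_of_nonneg (sub_nonneg.2 hz)] at this
  have hψx : ψ x ≤ v := by
    by_contra! h
    have h1 : φ x - x ≤ H / 2 := by
      rcases le_total (ψ x) x with h2 | h2
      · have h3 := hLb _ h2
        rw [hφψ] at h3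
        have : L * (x - ψ x) ≤ L * (x - v) := mul_le_mul_of_nonneg_left (by linarith) hL0.le
        linarith
      · have := hφ h2
        rw [hφψ] at this
        linarith
    linarith
  have h1 : 0 ≤ ∫ z in ψ x..v, (φ z - x) := by
    refine integral_nonneg hψx fun z hz => ?_
    have := hφ hz.1
    rw [hφψ] at this
    linarith
  have h2 : ∫ z in v..x, H / 2 ≤ ∫ z in v..x, (φ z - x) := by
    refine integral_mono_on hvx (by simp) (hφi _ _) fun z hz => ?_
    have h3 := hLb z hz.2
    have : L * (x - z) ≤ L * (x - v) := mul_le_mul_of_nonneg_left (by linarith [hz.1]) hL0.le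
    linarith
  rw [← integral_add_adjacent_intervals (hφi (ψ x) v) (hφi v x)]
  simp only [integral_const, smul_eq_mul] at h2
  have h3 : 4 * L * ((x - v) * (H / 2)) = H ^ 2 := by
    have : 4 * L * ((x - v) * (H / 2)) = 4 * (L * (x - v)) * (H / 2) := by ring
    rw [this, hLv]; ring
  have h4 := mul_le_mul_of_nonneg_left (add_le_add h1 h2) (by positivity : 0 ≤ 4 * L)
  linarith

end Young

/-! ### Word length and displacement -/

section WordLength

variable {Γ : Type u} [Group Γ] {S : Finset Γ}

theorem exists_word (hS : Subgroup.closure (S : Set Γ) = ⊤) (g : Γ) :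
    ∃ w : List Γ, w.length = wordLength S g ∧ (∀ x ∈ w, x ∈ S ∨ x⁻¹ ∈ S) ∧ w.prod = g := by
  have hne : {n : ℕ | ∃ w : List Γ, w.length = n ∧ (∀ x ∈ w, x ∈ S ∨ x⁻¹ ∈ S) ∧
      w.prod = g}.Nonempty := by
    have hg : g ∈ (Subgroup.closure (S : Set Γ)).toSubmonoid := by rw [hS]; trivial
    rw [Subgroup.closure_toSubmonoid] at hg
    obtain ⟨l, hl, hg⟩ := Submonoid.exists_list_of_mem_closure hg
    exact ⟨l.length, l, rfl, hl, hg⟩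
  exact Nat.sInf_mem hne

theorem abs_sub_le_mul_wordLength (hS : Subgroup.closure (S : Set Γ) = ⊤) {φ : Γ → ℝ → ℝ}
    (h1 : ∀ x, φ 1 x = x) (hmul : ∀ g k x, φ (g * k) x = φ g (φ k x)) {B : ℝ}
    (hB : ∀ s : Γ, (s ∈ S ∨ s⁻¹ ∈ S) → ∀ x, |φ s x - x| ≤ B) (g : Γ) (x : ℝ) :
    |φ g x - x| ≤ B * wordLength S g := by
  obtain ⟨w, hw, hwS, rfl⟩ := exists_word hS g
  rw [← hw]
  clear hw
  induction w with
  | nil => simp [h1]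
  | cons s w ih =>
    have h2 := ih fun x hx => hwS x (List.mem_cons_of_mem _ hx)
    have h3 := hB s (hwS s List.mem_cons_self) (φ w.prod x)
    rw [List.prod_cons, hmul, List.length_cons]
    push_cast
    have := abs_sub_le (φ s (φ w.prod x)) (φ w.prod x) x
    linarith

end WordLength

/-! ### Displacement and energy of interval actions -/

namespace IsResolventAction

open intervalIntegral
open MeasureTheory (volume)

variable {Γ : Type u} [Group Γ] {m : Γ → ℝ} {c ε : ℝ} {φ : Γ → ℝ → ℝ} {f : ℝ → ℝ}

theorem apply_inv (h : IsResolventAction m c ε φ f) (g : Γ) (x : ℝ) : φ g (φ g⁻¹ x) = x := by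
  rw [← h.mul, mul_inv_cancel, h.one]

theorem inv_apply (h : IsResolventAction m c ε φ f) (g : Γ) (x : ℝ) : φ g⁻¹ (φ g x) = x := by
  rw [← h.mul, inv_mul_cancel, h.one]

theorem lipschitz (h : IsResolventAction m c ε φ f) (hm : ∀ g, 0 < m g) (g : Γ) (u v : ℝ) :
    |φ g v - φ g u| ≤ 2 / m g * |v - u| := by
  have key : ∀ u v, u ≤ v → |φ g v - φ g u| ≤ 2 / m g * |v - u| := by
    intro u v huv
    rw [abs_of_nonneg (sub_nonneg.2 (h.mono g huv)), abs_of_nonneg (sub_nonneg.2 huv),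
      div_mul_eq_mul_div, le_div_iff₀ (hm g), mul_comm]
    exact h.sub_le g u v huv
  rcases le_total u v with huv | huv
  · exact key u v huv
  · rw [abs_sub_comm, abs_sub_comm v]
    exact key v u huv

theorem abs_sub_le_one (h : IsResolventAction m c ε φ f) (g : Γ) (x : ℝ) : |φ g x - x| ≤ 1 := by
  by_cases hx : x ∈ Set.Ioo (0 : ℝ) 1
  · have h0 := h.mono g hx.1.le
    have h1 := h.mono g hx.2.le
    rw [h.eq_self g 0 (by simp)] at h0
    rw [h.eq_self g 1 (by simp)] at h1
    rw [abs_le]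
    constructor <;> linarith [hx.1, hx.2]
  · simp [h.eq_self g x hx]

theorem abs_drift_le_one (h : IsResolventAction m c ε φ f) (x : ℝ) : |x - f x| ≤ 1 := by
  by_cases hx : x ∈ Set.Icc (0 : ℝ) 1
  · have := h.drift_mem x hx
    rw [abs_le]
    constructor <;> linarith [hx.1, hx.2, this.1, this.2]
  · simp [h.drift_eq_self x hx]

theorem drift_intervalIntegrable (h : IsResolventAction m c ε φ f) (a b : ℝ) :
    IntervalIntegrable (fun z => z - f z) volume a b :=
  (continuous_id.intervalIntegrable a b).sub h.mono_drift.intervalIntegrable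

/-- The integrand is `z` on `[0, c]` and bounded by 1 between `c` and `x`. -/
theorem le_integral_drift (h : IsResolventAction m c ε φ f) (hc : 0 ≤ c) (x : ℝ) :
    c ^ 2 / 2 - |x - c| ≤ ∫ z in (0 : ℝ)..x, (z - f z) := by
  rw [← integral_add_adjacent_intervals (h.drift_intervalIntegrable 0 c)
    (h.drift_intervalIntegrable c x)]
  have h1 : ∫ z in (0 : ℝ)..c, (z - f z) = c ^ 2 / 2 := by
    have : ∫ z in (0 : ℝ)..c, (z - f z) = ∫ z in (0 : ℝ)..c, z := by
      refine integral_congr fun z hz => ?_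
      rw [Set.uIcc_of_le hc] at hz
      simp [h.drift_eq_zero z hz.1 hz.2]
    rw [this, integral_id]
    ring
  have h2 : ‖∫ z in c..x, (z - f z)‖ ≤ 1 * |x - c| :=
    norm_integral_le_of_norm_le_const fun z _ => h.abs_drift_le_one z
  rw [one_mul, Real.norm_eq_abs] at h2
  linarith [(abs_le.1 h2).1]

theorem integral_drift_le (h : IsResolventAction m c ε φ f) {x : ℝ} (hx : x ∈ Set.Icc (0 : ℝ) 1) :
    ∫ z in (0 : ℝ)..x, (z - f z) ≤ 1 := by
  have h2 : ‖∫ z in (0 : ℝ)..x, (z - f z)‖ ≤ 1 * |x - 0| :=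
    norm_integral_le_of_norm_le_const fun z _ => h.abs_drift_le_one z
  rw [one_mul, Real.norm_eq_abs, sub_zero, abs_of_nonneg hx.1] at h2
  linarith [(abs_le.1 h2).2, hx.2]

/-- By symmetry of `m`, twice the drift is the mean of `φ k z + φ k⁻¹ z - 2 * z`; integrating
termwise and applying Young's equality gives the areas. -/
theorem hasSum_excess (h : IsResolventAction m c ε φ f) [Countable Γ] (hm : ∀ g, 0 < m g)
    (hm1 : HasSum m 1) (hsymm : ∀ g, m g⁻¹ = m g) (x : ℝ) :
    HasSum (fun k => m k * ∫ z in φ k⁻¹ x..x, (φ k z - x))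
      (2 * ε * ∫ z in (0 : ℝ)..x, (z - f z)) := by
  have hpt : ∀ z, HasSum (fun k => m k * (φ k z + φ k⁻¹ z - 2 * z)) (2 * ε * (z - f z)) := by
    intro z
    have h1 := h.hasSum z
    have h2 := (Equiv.inv Γ).hasSum_iff.2 h1
    have h3 := h1.add h2
    have e : 2 * ε * (z - f z) = ε * (z - f z) + ε * (z - f z) := by ring
    rw [e]
    refine h3.of_forall_eq fun k => ?_
    simp only [Function.comp_apply, Equiv.inv_apply, hsymm]
    ring
  have hint : HasSum (fun k => ∫ z in (0 : ℝ)..x, m k * (φ k z + φ k⁻¹ z - 2 * z))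
      (∫ z in (0 : ℝ)..x, 2 * ε * (z - f z)) := by
    refine hasSum_integral_of_dominated_convergence (fun k _ => 2 * m k) (fun k => ?_)
      (fun k => ?_) ?_ ?_ ?_
    · have h1 := (h.mono k).measurable
      have h2 := (h.mono k⁻¹).measurable
      exact (((h1.add h2).sub (measurable_id.const_mul 2)).const_mul (m k)).aestronglyMeasurable
    · refine Filter.Eventually.of_forall fun z _ => ?_
      rw [norm_mul, Real.norm_eq_abs, Real.norm_eq_abs, abs_of_pos (hm k), mul_comm]
      refine mul_le_mul_of_nonneg_right ?_ (hm k).le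
      have h1 := abs_le.1 (h.abs_sub_le_one k z)
      have h2 := abs_le.1 (h.abs_sub_le_one k⁻¹ z)
      rw [abs_le]
      constructor <;> linarith [h1.1, h1.2, h2.1, h2.2]
    · exact Filter.Eventually.of_forall fun z _ => hm1.summable.mul_left 2
    · simp
    · exact Filter.Eventually.of_forall fun z _ => hpt z
  rw [integral_const_mul] at hint
  refine hint.of_forall_eq fun k => ?_
  rw [integral_const_mul, integral_add_inverse_sub (h.mono k) (h.mono k⁻¹) (h.inv_apply k)
    (h.apply_inv k) (h.eq_self k 0 (by simp)) (h.lipschitz hm k)]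

theorem abs_sub_le (h : IsResolventAction m c ε φ f) [Countable Γ] (hm : ∀ g, 0 < m g)
    (hm1 : HasSum m 1) (hsymm : ∀ g, m g⁻¹ = m g) {δ : ℝ} (hδ : 0 < δ) (hε : ε = δ ^ 2)
    (g : Γ) (x : ℝ) : |φ g x - x| ≤ 8 / m g ^ 2 * δ := by
  by_cases hx : x ∈ Set.Icc (0 : ℝ) 1
  swap
  · rw [h.eq_self g x fun hx' => hx ⟨hx'.1.le, hx'.2.le⟩, sub_self, abs_zero]
    positivity
  have hmle : m g ≤ 1 := le_hasSum hm1 g fun k _ => (hm k).le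
  have hmg := hm g
  -- A single area is bounded by the whole sum. With `L = 2 / m g` this bounds the square of a
  -- rightward displacement by `8 / m g ^ 2 * (2 * δ ^ 2)`.
  have key : ∀ k, m k = m g → x ≤ φ k x → φ k x - x ≤ 4 / m g * δ := by
    intro k hk hkx
    have h1 := sq_le_integral_inverse_sub (h.mono k) (h.apply_inv k)
      (div_pos two_pos (hm k)) (h.lipschitz hm k) hkx
    have h2 := le_hasSum (h.hasSum_excess hm hm1 hsymm x) k fun j _ =>
      mul_nonneg (hm j).le (integral_inverse_sub_nonneg (h.mono j) (h.apply_inv j) x)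
    have h3 := h.integral_drift_le hx
    have h4 : m k * (∫ z in φ k⁻¹ x..x, (φ k z - x)) ≤ 2 * δ ^ 2 := by
      have : 2 * ε * (∫ z in (0 : ℝ)..x, (z - f z)) ≤ 2 * ε * 1 :=
        mul_le_mul_of_nonneg_left h3 (by rw [hε]; positivity)
      rw [← hε]; linarith
    rw [hk] at h1 h4
    set I := ∫ z in φ k⁻¹ x..x, (φ k z - x)
    have h5 : (φ k x - x) ^ 2 ≤ (4 / m g * δ) ^ 2 := by
      calc _ ≤ _ := h1
        _ = 8 / m g ^ 2 * (m g * I) := by field_simp; ring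
        _ ≤ 8 / m g ^ 2 * (2 * δ ^ 2) := mul_le_mul_of_nonneg_left h4 (by positivity)
        _ = _ := by field_simp; ring
    exact (le_abs_self _).trans (abs_le_of_sq_le_sq h5 (by positivity))
  have hle : 4 / m g * δ ≤ 8 / m g ^ 2 * δ := by
    refine mul_le_mul_of_nonneg_right ?_ hδ.le
    rw [div_le_div_iff₀ hmg (by positivity)]
    nlinarith
  rcases le_total x (φ g x) with hx' | hx'
  · rw [abs_of_nonneg (sub_nonneg.2 hx')]
    exact (key g rfl hx').trans hle
  -- If `g` moves `x` left, `g⁻¹` moves it right, and `φ g`, with Lipschitz constant `2 / m g`,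
  -- carries `[x, φ g⁻¹ x]` to `[φ g x, x]`.
  · have h1 := h.mono g⁻¹ hx'
    rw [h.inv_apply] at h1
    have h2 := key g⁻¹ (hsymm g) h1
    have h3 := h.lipschitz hm g x (φ g⁻¹ x)
    rw [h.apply_inv, abs_of_nonneg (sub_nonneg.2 h1)] at h3
    rw [abs_sub_comm]
    refine h3.trans ((mul_le_mul_of_nonneg_left h2 (by positivity)).trans_eq ?_)
    field_simp
    ring

end IsResolventAction

/-! ### Rescaled, almost harmonic actions -/

/-- A monotone action on the line whose displacements are bounded by `K` times the word length,
whose mean displacement is at most `δ`, and whose mean squared displacement is bounded below. -/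
structure IsAlmostHarmonic {Γ : Type u} [Group Γ] (m l : Γ → ℝ) (K c δ : ℝ) (ρ : Γ → ℝ → ℝ) :
    Prop where
  one : ∀ x, ρ 1 x = x
  mul : ∀ g k x, ρ (g * k) x = ρ g (ρ k x)
  lipschitz : ∀ g u v, |ρ g v - ρ g u| ≤ 2 / m g * |v - u|
  abs_sub_le : ∀ g x, |ρ g x - x| ≤ K * l g
  drift_le : ∀ x, |∑' k, m k * (ρ k x - x)| ≤ δ
  le_energy : ∀ x, c - 2 * δ * |x| ≤ ∑' k, m k * (|ρ k x - x| * |ρ k⁻¹ x - x|)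

theorem summable_displacement_mul {Γ : Type u} [Group Γ] {m l : Γ → ℝ} (hm : ∀ g, 0 < m g)
    (hinv : ∀ g, l g⁻¹ = l g)
    (hl2 : Summable fun g => l g ^ 2 * m g) {K : ℝ} {ρ : Γ → ℝ → ℝ}
    (h : ∀ g x, |ρ g x - x| ≤ K * l g) (x : ℝ) :
    Summable fun k => m k * (|ρ k x - x| * |ρ k⁻¹ x - x|) := by
  refine Summable.of_nonneg_of_le (fun k => ?_) (fun k => ?_) (hl2.mul_left (K ^ 2))
  · have := hm k
    positivity
  · have h1 := h k x
    have h2 := h k⁻¹ x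
    rw [hinv] at h2
    have h3 := mul_le_mul h1 h2 (abs_nonneg _) ((abs_nonneg _).trans h1)
    have h4 := mul_le_mul_of_nonneg_left h3 (hm k).le
    linarith

theorem wordLength_inv {Γ : Type u} [Group Γ] {S : Finset Γ}
    (hS : Subgroup.closure (S : Set Γ) = ⊤) (g : Γ) : wordLength S g⁻¹ = wordLength S g := by
  have key : ∀ g : Γ, wordLength S g⁻¹ ≤ wordLength S g := by
    intro g
    obtain ⟨w, hw, hwS, hg⟩ := exists_word hS g
    refine Nat.sInf_le ⟨(w.map (·⁻¹)).reverse, by simpa using hw, fun x hx => ?_, ?_⟩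
    · simp only [List.mem_reverse, List.mem_map] at hx
      obtain ⟨y, hy, rfl⟩ := hx
      rw [inv_inv]
      exact (hwS y hy).symm
    · rw [← List.prod_inv_reverse, hg]
  refine le_antisymm (key g) ?_
  simpa using key g⁻¹

theorem exists_isAlmostHarmonic {Γ : Type u} [Group Γ] [Nontrivial Γ] (hΓ : LeftOrderable Γ)
    {S : Finset Γ} (hS : Subgroup.closure (S : Set Γ) = ⊤) (μ : PMF Γ)
    (hsupp : μ.support = Set.univ) (hsymm : ∀ γ : Γ, μ γ⁻¹ = μ γ)
    (hmoment : Summable fun γ : Γ => (wordLength S γ : ℝ) ^ 2 * (μ γ).toReal) :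
    ∃ c K : ℝ, 0 < c ∧ ∀ δ : ℝ, 0 < δ → δ ≤ 1 → ∃ ρ : Γ → ℝ → ℝ,
      IsAlmostHarmonic (fun g => (μ g).toReal) (fun g => wordLength S g) K c δ ρ := by
  obtain ⟨c, hc0, hc1, hex⟩ := exists_resolventAction hΓ μ hsupp
  set m : Γ → ℝ := fun g => (μ g).toReal with hmdef
  have hm : ∀ g, 0 < m g := fun g => ENNReal.toReal_pos
    (by rw [← PMF.mem_support_iff, hsupp]; trivial) (μ.apply_ne_top g)
  have hm1 : HasSum m 1 := by
    have := ENNReal.hasSum_toReal (f := μ) (by rw [μ.tsum_coe]; simp)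
    rwa [← ENNReal.tsum_toReal_eq μ.apply_ne_top, μ.tsum_coe, ENNReal.toReal_one] at this
  have hms : ∀ g, m g⁻¹ = m g := fun g => by simp only [m, hsymm]
  have : Countable Γ := by
    rw [← Set.countable_univ_iff, ← hsupp]
    exact μ.support_countable
  set K : ℝ := ∑ s ∈ S, 8 / m s ^ 2 with hK
  refine ⟨c ^ 2, K, by positivity, fun δ hδ hδ1 => ?_⟩
  obtain ⟨φ, f, h⟩ := hex (δ ^ 2) (by positivity) (by nlinarith)
  have hdisp := h.abs_sub_le hm hm1 hms hδ rfl
  have hletter : ∀ s : Γ, (s ∈ S ∨ s⁻¹ ∈ S) → ∀ x, |φ s x - x| ≤ K * δ := by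
    intro s hs x
    refine (hdisp s x).trans (mul_le_mul_of_nonneg_right ?_ hδ.le)
    rcases hs with hs | hs
    · exact Finset.single_le_sum (f := fun s => 8 / m s ^ 2) (fun k _ => by positivity) hs
    · rw [← hms]
      exact Finset.single_le_sum (f := fun s => 8 / m s ^ 2) (fun k _ => by positivity) hs
  have hword := abs_sub_le_mul_wordLength hS h.one h.mul hletter
  -- Zooming in at `c` by `1 / δ` makes displacements of order 1, while the drift of order `δ ^ 2`
  -- becomes of order `δ`.
  set ρ : Γ → ℝ → ℝ := fun g y => (φ g (c + δ * y) - c) / δ with hρ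
  have hρsub : ∀ g y, ρ g y - y = (φ g (c + δ * y) - (c + δ * y)) / δ := by
    intro g y
    simp only [ρ]
    field_simp
    ring
  have hbound : ∀ g y, |ρ g y - y| ≤ K * wordLength S g := by
    intro g y
    rw [hρsub, abs_div, abs_of_pos hδ, div_le_iff₀ hδ]
    linarith [hword g (c + δ * y)]
  refine ⟨ρ, ⟨?_, ?_, ?_, hbound, ?_, ?_⟩⟩
  · intro y
    simp only [ρ, h.one]
    field_simp
    ring
  · intro g k y
    simp only [ρ, h.mul]
    congr 3
    field_simp
    ring
  · intro g u v
    have h1 := h.lipschitz hm g (c + δ * u) (c + δ * v)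
    have e1 : ρ g v - ρ g u = (φ g (c + δ * v) - φ g (c + δ * u)) / δ := by
      simp only [ρ]
      ring
    have e2 : c + δ * v - (c + δ * u) = δ * (v - u) := by ring
    rw [e2, abs_mul, abs_of_pos hδ] at h1
    rw [e1, abs_div, abs_of_pos hδ, div_le_iff₀ hδ]
    linarith
  · intro y
    have h1 := (h.hasSum (c + δ * y)).mul_right δ⁻¹
    have h2 : HasSum (fun k => m k * (ρ k y - y)) (δ * (c + δ * y - f (c + δ * y))) := by
      have e : δ * (c + δ * y - f (c + δ * y)) =
          δ ^ 2 * (c + δ * y - f (c + δ * y)) * δ⁻¹ := by field_simp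
      rw [e]
      refine h1.of_forall_eq fun k => ?_
      rw [hρsub]
      ring
    rw [h2.tsum_eq, abs_mul, abs_of_pos hδ]
    exact mul_le_of_le_one_right hδ.le (h.abs_drift_le_one _)
  · intro y
    set x := c + δ * y with hx
    have h1 := (h.hasSum_excess hm hm1 hms x).mul_right (δ ^ 2)⁻¹
    have h2 := h.le_integral_drift hc0.le x
    have h3 : |x - c| = δ * |y| := by
      rw [hx, add_sub_cancel_left, abs_mul, abs_of_pos hδ]
    have e : 2 * δ ^ 2 * (∫ z in (0 : ℝ)..x, (z - f z)) * (δ ^ 2)⁻¹ =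
        2 * ∫ z in (0 : ℝ)..x, (z - f z) := by field_simp
    rw [e] at h1
    have hsum := summable_displacement_mul (l := fun g => (wordLength S g : ℝ)) hm
      (fun g => by rw [wordLength_inv hS]) hmoment hbound y
    have h4 := hasSum_le (fun k => ?_) h1 hsum.hasSum
    · rw [h3] at h2
      linarith
    · have h5 := integral_inverse_sub_le (h.mono k) (h.apply_inv k) x
      rw [hρsub, hρsub, abs_div, abs_div, abs_of_pos hδ, ← hx]
      have h6 := mul_le_mul_of_nonneg_left h5 (hm k).le
      have h7 := mul_le_mul_of_nonneg_right h6 (by positivity : 0 ≤ (δ ^ 2)⁻¹)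
      refine h7.trans_eq ?_
      field_simp

/-! ### The compact space of harmonic actions -/

section HarmonicSpace

open Filter Topology

/-- The maps with displacement bounded by `K` times the length. -/
def displacementBox {Γ : Type u} (l : Γ → ℝ) (K : ℝ) : Set (Γ → ℝ → ℝ) :=
  Set.univ.pi fun g => Set.univ.pi fun x => Set.Icc (x - K * l g) (x + K * l g)

theorem isCompact_displacementBox {Γ : Type u} (l : Γ → ℝ) (K : ℝ) : IsCompact (displacementBox l K) :=
  isCompact_univ_pi fun _ => isCompact_univ_pi fun _ => isCompact_Icc

variable {Γ : Type u} [Group Γ] {m l : Γ → ℝ} {K c : ℝ}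

/-- Equi-Lipschitz bounds let compositions pass to the limit; the first and second moments dominate
the drift and energy series. This serves both closedness at `δ = 0` and existence as `δ → 0`. -/
theorem IsAlmostHarmonic.of_tendsto (hm : ∀ g, 0 < m g) (hl : ∀ g, l g⁻¹ = l g)
    (hl1 : Summable fun g => l g * m g) (hl2 : Summable fun g => l g ^ 2 * m g)
    {ι : Type*} {F : Filter ι} [NeBot F] {r : ι → Γ → ℝ → ℝ} {d : ι → ℝ} {ρ : Γ → ℝ → ℝ} {δ : ℝ}
    (hr : ∀ᶠ i in F, IsAlmostHarmonic m l K c (d i) (r i))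
    (hρ : ∀ g x, Tendsto (fun i => r i g x) F (𝓝 (ρ g x))) (hd : Tendsto d F (𝓝 δ)) :
    IsAlmostHarmonic m l K c δ ρ where
  one x := tendsto_nhds_unique (hρ 1 x)
    (tendsto_const_nhds.congr' (hr.mono fun _ h => (h.one x).symm))
  mul g k x := by
    refine tendsto_nhds_unique (hρ (g * k) x) ?_
    have h1 : Tendsto (fun i => r i g (r i k x) - r i g (ρ k x)) F (𝓝 0) := by
      have h2 : Tendsto (fun i => 2 / m g * |r i k x - ρ k x|) F (𝓝 0) := by
        have := (((hρ k x).sub_const (ρ k x)).abs).const_mul (2 / m g)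
        simpa using this
      exact squeeze_zero_norm' (hr.mono fun i h => h.lipschitz g _ _) h2
    have h2 := h1.add (hρ g (ρ k x))
    rw [zero_add] at h2
    exact h2.congr' (hr.mono fun i h => by simp only [h.mul, sub_add_cancel])
  lipschitz g u v := le_of_tendsto ((hρ g v).sub (hρ g u)).abs
    (hr.mono fun _ h => h.lipschitz g u v)
  abs_sub_le g x := le_of_tendsto ((hρ g x).sub_const x).abs (hr.mono fun _ h => h.abs_sub_le g x)
  drift_le x := by
    refine le_of_tendsto_of_tendsto (Tendsto.abs ?_) hd (hr.mono fun i h => h.drift_le x)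
    refine tendsto_tsum_of_dominated_convergence (hl1.mul_left K)
      (fun k => ((hρ k x).sub_const x).const_mul (m k)) (hr.mono fun i h k => ?_)
    rw [norm_mul, Real.norm_eq_abs, Real.norm_eq_abs, abs_of_pos (hm k)]
    have := mul_le_mul_of_nonneg_left (h.abs_sub_le k x) (hm k).le
    linarith
  le_energy x := by
    refine le_of_tendsto_of_tendsto (((hd.const_mul 2).mul_const |x|).const_sub c) ?_
      (hr.mono fun i h => h.le_energy x)
    refine tendsto_tsum_of_dominated_convergence (hl2.mul_left (K ^ 2))
      (fun k => (((hρ k x).sub_const x).abs.mul ((hρ k⁻¹ x).sub_const x).abs).const_mul (m k))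
      (hr.mono fun i h k => ?_)
    have h1 := h.abs_sub_le k x
    have h2 := h.abs_sub_le k⁻¹ x
    rw [hl] at h2
    have h3 := mul_le_mul h1 h2 (abs_nonneg _) ((abs_nonneg _).trans h1)
    have h4 := mul_le_mul_of_nonneg_left h3 (hm k).le
    have h5 := hm k
    rw [Real.norm_of_nonneg (by positivity)]
    linarith

/-- The space of harmonic actions of `Γ` on the line. -/
def harmonicActions (m l : Γ → ℝ) (K c : ℝ) : Set (Γ → ℝ → ℝ) :=
  {ρ | IsAlmostHarmonic m l K c 0 ρ}

theorem IsAlmostHarmonic.mem_displacementBox {δ : ℝ} {ρ : Γ → ℝ → ℝ}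
    (h : IsAlmostHarmonic m l K c δ ρ) : ρ ∈ displacementBox l K := by
  intro g _ x _
  have := abs_le.1 (h.abs_sub_le g x)
  constructor <;> linarith [this.1, this.2]

theorem isCompact_harmonicActions (hm : ∀ g, 0 < m g) (hl : ∀ g, l g⁻¹ = l g)
    (hl1 : Summable fun g => l g * m g) (hl2 : Summable fun g => l g ^ 2 * m g) (K c : ℝ) :
    IsCompact (harmonicActions m l K c) := by
  refine (isCompact_displacementBox l K).of_isClosed_subset ?_ fun ρ h => h.mem_displacementBox
  rw [isClosed_iff_ultrafilter]
  intro ρ U hU hmem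
  exact IsAlmostHarmonic.of_tendsto (r := id) hm hl hl1 hl2 hmem
    (fun g x => tendsto_pi_nhds.1 (tendsto_pi_nhds.1 hU g) x) tendsto_const_nhds

theorem harmonicActions_nonempty (hm : ∀ g, 0 < m g) (hl : ∀ g, l g⁻¹ = l g)
    (hl1 : Summable fun g => l g * m g) (hl2 : Summable fun g => l g ^ 2 * m g)
    (hex : ∀ δ : ℝ, 0 < δ → δ ≤ 1 → ∃ ρ, IsAlmostHarmonic m l K c δ ρ) :
    (harmonicActions m l K c).Nonempty := by
  have hex' : ∀ n : ℕ, ∃ ρ, IsAlmostHarmonic m l K c (1 / ((n : ℝ) + 1)) ρ := fun n =>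
    hex _ (by positivity) ((div_le_one (by positivity)).2 (by linarith [n.cast_nonneg (α := ℝ)]))
  choose r hr using hex'
  obtain ⟨ρ, -, hρ⟩ := (isCompact_displacementBox l K).ultrafilter_le_nhds
    ((hyperfilter ℕ).map r) (by
      rw [le_principal_iff, Ultrafilter.mem_coe, Ultrafilter.mem_map]
      exact Filter.univ_mem' fun n => (hr n).mem_displacementBox)
  refine ⟨ρ, IsAlmostHarmonic.of_tendsto (F := (hyperfilter ℕ : Filter ℕ)) hm hl hl1 hl2
    (Filter.Eventually.of_forall hr)
    (fun g x => tendsto_pi_nhds.1 (tendsto_pi_nhds.1 hρ g) x) ?_⟩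
  exact tendsto_one_div_add_atTop_nhds_zero_nat.mono_left Nat.hyperfilter_le_atTop

/-- At `δ = 0` the term in `|x|` disappears, so no point of the line is distinguished. -/
theorem IsAlmostHarmonic.translate {ρ : Γ → ℝ → ℝ} (h : IsAlmostHarmonic m l K c 0 ρ) (s : ℝ) :
    IsAlmostHarmonic m l K c 0 fun g x => ρ g (x + s) - s where
  one x := by simp [h.one]
  mul g k x := by simp [h.mul]
  lipschitz g u v := by simpa using h.lipschitz g (u + s) (v + s)
  abs_sub_le g x := by simpa [sub_sub, add_comm] using h.abs_sub_le g (x + s)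
  drift_le x := by simpa [sub_sub, add_comm] using h.drift_le (x + s)
  le_energy x := by simpa [sub_sub, add_comm] using h.le_energy (x + s)

theorem continuous_eval_harmonicActions (hm : ∀ g, 0 < m g) (g : Γ) :
    Continuous fun q : ℝ × harmonicActions m l K c => q.2.1 g q.1 := by
  have hc := hm g
  refine continuous_prod_of_continuous_lipschitzWith (fun q : ℝ × harmonicActions m l K c =>
    q.2.1 g q.1) (Real.toNNReal (2 / m g)) (fun x => ?_) fun ρ => ?_
  · exact (continuous_apply x).comp ((continuous_apply g).comp continuous_subtype_val)
  · refine LipschitzWith.of_dist_le_mul fun x y => ?_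
    rw [Real.coe_toNNReal _ (by positivity), Real.dist_eq, Real.dist_eq]
    exact ρ.2.lipschitz g y x

/-- Conjugation by the translations of the line. -/
def translationFlow (hm : ∀ g, 0 < m g) : Flow ℝ (harmonicActions m l K c) where
  toFun s ρ := ⟨fun g x => ρ.1 g (x + s) - s, ρ.2.translate s⟩
  cont' := by
    refine Continuous.subtype_mk (continuous_pi fun g => continuous_pi fun x => ?_) _
    exact ((continuous_eval_harmonicActions hm g).comp
      (((continuous_const (y := x)).add continuous_fst).prodMk continuous_snd)).sub continuous_fst
  map_add' s t ρ := by
    refine Subtype.ext (funext fun g => funext fun x => ?_)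
    change ρ.1 g (x + (s + t)) - (s + t) = ρ.1 g (x + s + t) - t - s
    rw [add_assoc]; ring
  map_zero' ρ := by
    refine Subtype.ext (funext fun g => funext fun x => ?_)
    change ρ.1 g (x + 0) - 0 = ρ.1 g x
    simp

/-- By continuity an action is determined by its countably many values at rational points;
compactness makes this injection an embedding. -/
theorem metrizableSpace_harmonicActions [Countable Γ] (hm : ∀ g, 0 < m g)
    [CompactSpace (harmonicActions m l K c)] :
    TopologicalSpace.MetrizableSpace (harmonicActions m l K c) := by
  have hcont : Continuous fun (ρ : harmonicActions m l K c) (q : Γ × ℚ) => ρ.1 q.1 (q.2 : ℝ) :=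
    continuous_pi fun q =>
      (continuous_apply (q.2 : ℝ)).comp ((continuous_apply q.1).comp continuous_subtype_val)
  refine (hcont.isClosedEmbedding fun ρ σ h => ?_).isEmbedding.metrizableSpace
  refine Subtype.ext (funext fun g => ?_)
  have hcts : ∀ ρ : harmonicActions m l K c, Continuous (ρ.1 g) := fun ρ =>
    (continuous_eval_harmonicActions hm g).comp (continuous_id.prodMk continuous_const)
  refine Rat.denseRange_cast.equalizer (hcts ρ) (hcts σ) (funext fun q => ?_)
  exact congrFun h (g, q)

theorem IsAlmostHarmonic.hasSum (hm : ∀ g, 0 < m g) (hl1 : Summable fun g => l g * m g)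
    {ρ : Γ → ℝ → ℝ} (h : IsAlmostHarmonic m l K c 0 ρ) (x : ℝ) :
    HasSum (fun k => (ρ k x - x) * m k) 0 := by
  have hs : Summable fun k => m k * (ρ k x - x) := by
    refine Summable.of_norm_bounded (hl1.mul_left K) fun k => ?_
    rw [norm_mul, Real.norm_eq_abs, Real.norm_eq_abs, abs_of_pos (hm k)]
    have := mul_le_mul_of_nonneg_left (h.abs_sub_le k x) (hm k).le
    linarith
  have h1 := hs.hasSum
  rw [abs_nonpos_iff.1 (h.drift_le x)] at h1
  exact h1.of_forall_eq fun k => mul_comm _ _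

theorem IsAlmostHarmonic.exists_ne (hc : 0 < c) {ρ : Γ → ℝ → ℝ}
    (h : IsAlmostHarmonic m l K c 0 ρ) (x : ℝ) : ∃ g, ρ g x ≠ x := by
  by_contra! hx
  have := h.le_energy x
  simp [hx] at this
  linarith

end HarmonicSpace

/-! ### Minimal sets of flows -/

section MinimalSet

open Set

theorem exists_minimal_invariant {X : Type*} [TopologicalSpace X] [CompactSpace X] [Nonempty X]
    (T : Flow ℝ X) : ∃ M : Set X, IsClosed M ∧ M.Nonempty ∧ IsInvariant T M ∧
      ∀ x ∈ M, M ⊆ closure (T.orbit x) := by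
  obtain ⟨M, ⟨⟨hMc, hMn, hMi⟩, hmin⟩⟩ := zorn_superset
    {s : Set X | IsClosed s ∧ s.Nonempty ∧ IsInvariant T s} (by
      intro C hC hchain
      rcases C.eq_empty_or_nonempty with rfl | hCn
      · exact ⟨univ, ⟨isClosed_univ, univ_nonempty, fun _ => mapsTo_univ _ _⟩, by simp⟩
      · have : Nonempty C := hCn.to_subtype
        refine ⟨⋂₀ C, ⟨isClosed_sInter fun s hs => (hC hs).1, ?_, fun t x hx s hs =>
          (hC hs).2.2 t (hx s hs)⟩, fun s hs => sInter_subset_of_mem hs⟩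
        exact IsCompact.nonempty_sInter_of_directed_nonempty_isCompact_isClosed
          (fun a ha b hb => (hchain.total ha hb).elim
            (fun h => ⟨a, ha, subset_rfl, h⟩) fun h => ⟨b, hb, h, subset_rfl⟩) (fun s hs => (hC hs).2.1) (fun s hs => (hC hs).1.isCompact)
          (fun s hs => (hC hs).1))
  refine ⟨M, hMc, hMn, hMi, fun x hx => hmin ⟨isClosed_closure, ?_, fun t => ?_⟩ ?_⟩
  · exact ⟨x, subset_closure ⟨0, T.map_zero_apply x⟩⟩
  · exact (T.isInvariant_orbit x t).closure (T.continuous_toFun t)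
  · refine closure_minimal ?_ hMc
    rintro _ ⟨t, rfl⟩
    exact hMi t hx

end MinimalSet

/-! ### Freeness by an irrational torus flow -/

/-- The product of two flows. -/
def Flow.prodMap {X Y : Type*} [TopologicalSpace X] [TopologicalSpace Y] (T : Flow ℝ X)
    (R : Flow ℝ Y) : Flow ℝ (X × Y) where
  toFun s q := (T s q.1, R s q.2)
  cont' := by
    refine Continuous.prodMk ?_ ?_
    · exact T.continuous continuous_fst (continuous_fst.comp continuous_snd)
    · exact R.continuous continuous_fst (continuous_snd.comp continuous_snd)
  map_add' s t q := by simp [Flow.map_add]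
  map_zero' q := by simp

/-- The linear flow of slope `√2` on the torus. -/
noncomputable def torusFlow : Flow ℝ (UnitAddCircle × UnitAddCircle) where
  toFun s q := (q.1 + (s : UnitAddCircle), q.2 + ((√2 * s : ℝ) : UnitAddCircle))
  cont' := by
    have h : Continuous fun s : ℝ => (s : UnitAddCircle) := AddCircle.continuous_mk' 1
    refine Continuous.prodMk ?_ ?_
    · exact (continuous_fst.comp continuous_snd).add (h.comp continuous_fst)
    · exact (continuous_snd.comp continuous_snd).add
        (h.comp (continuous_const.mul continuous_fst))
  map_add' s t q := by
    ext
    · simp only [AddCircle.coe_add]; abel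
    · simp only [mul_add, AddCircle.coe_add]; abel
  map_zero' q := by simp

/-- Both `s` and `√2 * s` would be integers. -/
theorem torusFlow_eq_self {s : ℝ} {q : UnitAddCircle × UnitAddCircle}
    (h : torusFlow s q = q) : s = 0 := by
  have h1 : q.1 + (s : UnitAddCircle) = q.1 := congrArg Prod.fst h
  have h2 : q.2 + ((√2 * s : ℝ) : UnitAddCircle) = q.2 := congrArg Prod.snd h
  rw [add_eq_left, AddCircle.coe_eq_zero_iff] at h1 h2
  obtain ⟨n, hn⟩ := h1
  obtain ⟨k, hk⟩ := h2
  simp only [zsmul_eq_mul, mul_one] at hn hk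
  by_contra hs
  refine irrational_sqrt_two ⟨(k : ℚ) / n, ?_⟩
  rw [← hn] at hk hs
  push_cast
  rw [hk]
  field_simp

/-! ### Action along trajectories and conclusion -/

section Action

variable {Γ : Type u} [Group Γ] {Z : Type*} [TopologicalSpace Z]

/-- The action along the trajectories of a flow that is given by a cocycle. -/
@[reducible] def cocycleAction (T : Flow ℝ Z) (t : Γ → Z → ℝ) (h1 : ∀ z, t 1 z = 0)
    (hmul : ∀ g k z, t (g * k) z = t g (T (t k z) z) + t k z) : MulAction Γ Z where
  smul g z := T (t g z) z
  one_smul z := by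
    change T (t 1 z) z = z
    rw [h1, T.map_zero_apply]
  mul_smul g k z := by
    change T (t (g * k) z) z = T (t g (T (t k z) z)) (T (t k z) z)
    rw [hmul, T.map_add]

end Action

theorem theorem5p4 {Γ : Type u} [Group Γ] [Nontrivial Γ]
    (S : Finset Γ) (hS : Subgroup.closure (S : Set Γ) = ⊤)
    (hΓ : LeftOrderable Γ)
    (μ : PMF Γ)
    (hsymm : ∀ γ : Γ, μ γ⁻¹ = μ γ)
    (hsupp : μ.support = Set.univ)
    (hmoment : Summable fun γ : Γ => (wordLength S γ : ℝ) ^ 2 * (μ γ).toReal) :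
    ∃ (Z : Type u) (_ : TopologicalSpace Z) (_ : MulAction Γ Z) (T : Flow ℝ Z),
      Nonempty Z ∧ CompactSpace Z ∧ TopologicalSpace.MetrizableSpace Z ∧
      -- the group acts by homeomorphisms
      ContinuousConstSMul Γ Z ∧
      IsFreeFlow T ∧
      IsMinimalFlow T ∧
      -- there is no global fixed point
      (∀ p : Z, ∃ γ : Γ, γ • p ≠ p) ∧
      -- each trajectory of the flow is invariant under the group
      (∀ (γ : Γ) (p : Z), (fun q => γ • q) '' T.orbit p = T.orbit p) ∧
      -- the displacement function exists, is unique, and has zero mean at every point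
      -- (the series over the group converges absolutely, with sum zero)
      (∃! t : Γ → Z → ℝ, IsDisplacement T t) ∧
      (∀ t : Γ → Z → ℝ, IsDisplacement T t →
        ∀ p : Z, HasSum (fun γ : Γ => t γ p * (μ γ).toReal) 0) := by
  obtain ⟨c, K, hc, hex⟩ := exists_isAlmostHarmonic hΓ hS μ hsupp hsymm hmoment
  set m : Γ → ℝ := fun g => (μ g).toReal with hmdef
  set l : Γ → ℝ := fun g => wordLength S g with hldef
  have hm : ∀ g, 0 < m g := fun g => ENNReal.toReal_pos
    (by rw [← PMF.mem_support_iff, hsupp]; trivial) (μ.apply_ne_top g)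
  have hl : ∀ g, l g⁻¹ = l g := fun g => by simp only [l, wordLength_inv hS]
  have hl1 : Summable fun g => l g * m g := by
    refine Summable.of_nonneg_of_le (fun g => mul_nonneg (Nat.cast_nonneg _) (hm g).le)
      (fun g => mul_le_mul_of_nonneg_right ?_ (hm g).le) hmoment
    simp only [l]
    exact_mod_cast Nat.le_self_pow two_ne_zero _
  have : Countable Γ := by
    rw [← Set.countable_univ_iff, ← hsupp]
    exact μ.support_countable
  have : CompactSpace (harmonicActions m l K c) :=
    isCompact_iff_compactSpace.1 (isCompact_harmonicActions hm hl hl1 hmoment K c)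
  have : TopologicalSpace.MetrizableSpace (harmonicActions m l K c) :=
    metrizableSpace_harmonicActions hm
  have : Nonempty (harmonicActions m l K c) :=
    (harmonicActions_nonempty hm hl hl1 hmoment hex).to_subtype
  -- A harmonic action may commute with a translation of the line; the torus factor removes such
  -- periods.
  set T₀ : Flow ℝ (harmonicActions m l K c × UnitAddCircle × UnitAddCircle) :=
    (translationFlow hm).prodMap torusFlow with hT₀
  obtain ⟨M, hMc, hMn, hMi, hMd⟩ := exists_minimal_invariant T₀
  set T : Flow ℝ M := T₀.restrict hMi with hT
  have hfree : IsFreeFlow T := fun s p hp =>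
    torusFlow_eq_self (congrArg Prod.snd (congrArg Subtype.val hp))
  -- Flowing for time `s` turns the displacement of 0 into that of `s`, so the cocycle identity is
  -- the multiplicativity of the action at 0.
  set t : Γ → M → ℝ := fun g p => p.1.1.1 g 0 with ht
  have htT : ∀ g s p, t g (T s p) = p.1.1.1 g (0 + s) - s := fun _ _ _ => rfl
  have ht1 : ∀ p, t 1 p = 0 := fun p => p.1.1.2.one 0
  have htmul : ∀ g k p, t (g * k) p = t g (T (t k p) p) + t k p := fun g k p => by
    rw [htT, sub_add_cancel, zero_add]
    exact p.1.1.2.mul g k 0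
  have htcont : ∀ g, Continuous (t g) := fun g =>
    (continuous_eval_harmonicActions hm g).comp
      (continuous_const.prodMk (continuous_fst.comp continuous_subtype_val))
  let act : MulAction Γ M := cocycleAction T t ht1 htmul
  have hsmul : IsDisplacement T t := fun _ _ => rfl
  have huniq : ∀ t', IsDisplacement T t' → t' = t := fun t' ht' => by
    funext g p
    have h1 : T (t' g p) p = T (t g p) p := (ht' g p).symm.trans (hsmul g p)
    have h2 : T (-t g p + t' g p) p = p := by
      rw [T.map_add, h1, ← T.map_add, neg_add_cancel, T.map_zero_apply]
    linarith [hfree _ _ h2]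
  have hmaps : ∀ (g : Γ) (p q : M), q ∈ T.orbit p → g • q ∈ T.orbit p := fun g p q hq => by
    rw [hsmul]
    exact T.isInvariant_orbit p _ hq
  refine ⟨M, inferInstance, act, T, hMn.to_subtype, isCompact_iff_compactSpace.1 hMc.isCompact,
    inferInstance, ⟨fun g => ?_⟩, hfree, fun p => ?_, fun p => ?_, fun g p => ?_,
    ⟨t, hsmul, huniq⟩, fun t' ht' p => ?_⟩
  · exact T.continuous (htcont g) continuous_id
  · rw [dense_iff_closure_eq, Set.eq_univ_iff_forall]
    intro q
    rw [closure_subtype]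
    have h1 := hMd p.1 p.2 q.2
    refine closure_mono ?_ h1
    rintro _ ⟨s, rfl⟩
    exact ⟨T s p, ⟨s, rfl⟩, rfl⟩
  · obtain ⟨g, hg⟩ := p.1.1.2.exists_ne hc 0
    exact ⟨g, fun h => hg (hfree _ _ h)⟩
  · refine Set.Subset.antisymm ?_ fun q hq => ?_
    · rintro _ ⟨q, hq, rfl⟩
      exact hmaps g p q hq
    · exact ⟨g⁻¹ • q, hmaps g⁻¹ p q hq, smul_inv_smul g q⟩
  · rw [huniq t' ht']
    simpa using p.1.1.2.hasSum hm hl1 0
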